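/- Let $\mathbb K=\mathbb R$ or $\mathbb K=\mathbb C$. For an integer $m\ge 1$ call a real number $C$ \emph{admissible} for $m$ if $$\Bigl(\sum_{i_1,\dots,i_m=1}^{N}|U(e_{i_1},\dots,e_{i_m})|^{\frac{2m}{m+1}}\Bigr)^{\frac{m+1}{2m}}\le C\,\sup_{z_1,\dots,z_m\in\mathbb D^N}|U(z_1,\dots,z_m)|$$ for every integer $N\ge 1$ and every $m$-linear form $U:\mathbb K^N\times\cdots\times\mathbb K^N\to\mathbb K$, where $(e_i)_{i=1}^N$ is the canonical basis of $\mathbb K^N$ and $\mathbb D^N=\{z\in\mathbb K^N: |z_j|<1 \text{ for all } j\}$. Let $K_m$, the optimal constant in the Bohnenblust--Hille inequality over $\mathbb K$, be the infimum of the admissible constants for $m$. Then: 1. For every $m\ge1$, $K_m$ is the least admissible constant for $m$ (in particular it is finite), and $K_m\ge 1$. 2. There is a nondecreasing sequence $(C_m)$ of positive real numbers with $K_m\le C_m$ for all $m\ge1$ and $\lim_{m\to\infty} C_m/C_{m-1}=1$. 3. The growth in 2 is the best possible: if $(C'_m)_{m\ge1}$ is any sequence such that $C'_m$ is admissible for $m$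 for every $m\geq 1$ and $C'_m/C'_{m-1}\to L$ for some $L\in\mathbb R$, then $L\ge 1$. Moreover, if $K_m/K_{m-1}$ converges to a real number $L$, then $L=1$. 4. The optimal constants grow subexponentially: $K_m=o(a^m)$ as $m\to\infty$ for every $a>1$. -/

import Mathlib

open Filter Topology Asymptotics

namespace BohnenblustHille

/-- The open unit polydisk of `𝕜^N` (the open cube `(-1, 1)^N` when `𝕜 = ℝ`). -/
def polydisk (𝕜 : Type*) [RCLike 𝕜] (N : ℕ) : Set (Fin N → 𝕜) :=
  {z | ∀ j, ‖z j‖ < 1}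

/-- The canonical basis vector `e_i` of `𝕜^N`. -/
def stdVec (𝕜 : Type*) [RCLike 𝕜] {N : ℕ} (i : Fin N) : Fin N → 𝕜 :=
  Pi.single i 1

/-- The supremum of `|U(z_1, …, z_m)|` over `z_1, …, z_m` in the open unit polydisk of `𝕜^N`. -/
noncomputable def polydiskSup {𝕜 : Type*} [RCLike 𝕜] {m N : ℕ}
    (U : MultilinearMap 𝕜 (fun _ : Fin m => Fin N → 𝕜) 𝕜) : ℝ :=
  ⨆ z : {z : Fin m → Fin N → 𝕜 // ∀ k, z k ∈ polydisk 𝕜 N}, ‖U z.1‖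

/-- The supremum in `polydiskSup` is a supremum of a bounded set of reals. -/
theorem bddAbove_polydiskSup {𝕜 : Type*} [RCLike 𝕜] {m N : ℕ}
    (U : MultilinearMap 𝕜 (fun _ : Fin m => Fin N → 𝕜) 𝕜) :
    BddAbove (Set.range fun z : {z : Fin m → Fin N → 𝕜 // ∀ k, z k ∈ polydisk 𝕜 N} =>
      ‖U z.1‖) := by
  have hU : Continuous U := by
    have h : (U : (Fin m → Fin N → 𝕜) → 𝕜) = fun z =>
        ∑ i : Fin m → Fin N, (∏ k, z k (i k)) • U (fun k => stdVec 𝕜 (i k)) := by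
      funext z
      have hz : z = fun k => ∑ j, z k j • stdVec 𝕜 j := by
        funext k j
        simp [stdVec, Pi.single_apply]
      conv_lhs => rw [hz]
      rw [U.map_sum]
      exact Finset.sum_congr rfl fun i _ => U.map_smul_univ _ _
    rw [h]
    fun_prop
  have hc : IsCompact (Metric.closedBall (0 : Fin m → Fin N → 𝕜) 1) :=
    isCompact_closedBall _ _
  refine (hc.bddAbove_image (f := fun z => ‖U z‖) hU.norm.continuousOn).mono ?_
  rintro _ ⟨z, rfl⟩
  refine ⟨z.1, ?_, rfl⟩
  rw [mem_closedBall_zero_iff, pi_norm_le_iff_of_nonneg zero_le_one]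
  intro k
  rw [pi_norm_le_iff_of_nonneg zero_le_one]
  exact fun j => (z.2 k j).le

/-- `C` is an admissible constant in the `m`-linear Bohnenblust--Hille inequality over `𝕜`:
`(∑ |U(e_{i_1}, …, e_{i_m})|^{2m/(m+1)})^{(m+1)/(2m)} ≤ C sup |U|` for every positive integer `N`
and every `m`-linear form `U` on `𝕜^N × ⋯ × 𝕜^N`. -/
def Admissible (𝕜 : Type*) [RCLike 𝕜] (m : ℕ) (C : ℝ) : Prop :=
  ∀ N : ℕ, 1 ≤ N → ∀ U : MultilinearMap 𝕜 (fun _ : Fin m => Fin N → 𝕜) 𝕜,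
    (∑ i : Fin m → Fin N,
        ‖U (fun k => stdVec 𝕜 (i k))‖ ^ (2 * (m : ℝ) / ((m : ℝ) + 1))) ^
          (((m : ℝ) + 1) / (2 * (m : ℝ)))
      ≤ C * polydiskSup U

/-- The optimal constant `K_m` in the `m`-linear Bohnenblust--Hille inequality over `𝕜`. -/
noncomputable def optConst (𝕜 : Type*) [RCLike 𝕜] (m : ℕ) : ℝ :=
  sInf {C : ℝ | Admissible 𝕜 m C}

end BohnenblustHille

/-!
The upper bound for the optimal constants rests on the recursion `K_m ≤ 3^{1/(2(m-1))} K_{m-1}`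
(`Admissible.succ`), starting from `K_1 ≤ 1` (`admissible_one`).

Let `a` be the coefficients of an `m`-linear form `U`. Blei's inequality
(`sum_rpow_le_prod_sum_rpow`) bounds the `ℓ^{2m/(m+1)}`-norm of `a` by the geometric mean over `j`
of the mixed norms that are `ℓ²` in the `j`-th index and `ℓ^p`, `p = 2(m-1)/m`, in the others. It
follows from one application of Hölder's inequality and the Loomis–Whitney inequality
(`sum_prod_removeNth_rpow_le`). Khinchine's inequality (`rpow_sum_sq_le_sum_signSum`) replaces the
`ℓ²`-norm by an `L^p`-average over signs `ε`, and `p` is the Bohnenblust–Hille exponent of the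
`(m-1)`-linear form obtained from `U` by fixing the `j`-th argument at `ε`, whose supremum is at
most that of `U`. The constant in Khinchine's inequality comes from interpolating the second moment
between the `p`-th and the fourth, and it tends to `1` since `p → 2`.

Thus `C_m = 3^{(1 + 1/2 + ⋯ + 1/(m-1))/2}` is admissible, it is nondecreasing, and its successive
ratios tend to `1`. By the ratio test `K_m ≤ C_m = o(a^m)` for every `a > 1`, which excludes a ratio
limit above `1` for the optimal constants. A product of coordinates shows that admissible constants
are at least `1`, and therefore no sequence of them can have a ratio limit below `1`. The infimum
`K_m` is attained because admissibility is a closed condition on the constant.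
-/

namespace BohnenblustHille

/-! ### Finite Hölder and Loomis–Whitney inequalities -/

/-- Hölder's inequality for finitely many nonnegative functions with positive weights of
total mass one. -/
theorem sum_prod_rpow_le {α κ : Type*} [Fintype α] [Fintype κ] (f : κ → α → ℝ) (w : κ → ℝ)
    (hf : ∀ j a, 0 ≤ f j a) (hw : ∀ j, 0 < w j) (hw1 : ∑ j, w j = 1) :
    ∑ a, ∏ j, f j a ^ w j ≤ ∏ j, (∑ a, f j a) ^ w j := by
  have hF : ∀ j, 0 ≤ ∑ a, f j a := fun j => Finset.sum_nonneg fun a _ => hf j a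
  by_cases h0 : ∃ j, ∑ a, f j a = 0
  · obtain ⟨j, hj⟩ := h0
    have hja : ∀ a, f j a = 0 := fun a =>
      (Finset.sum_eq_zero_iff_of_nonneg fun a _ => hf j a).1 hj a (Finset.mem_univ a)
    have hl : ∀ a, ∏ j, f j a ^ w j = 0 := fun a =>
      Finset.prod_eq_zero (Finset.mem_univ j) (by rw [hja a, Real.zero_rpow (hw j).ne'])
    simp only [hl, Finset.sum_const_zero]
    exact Finset.prod_nonneg fun j _ => Real.rpow_nonneg (hF j) _
  · push Not at h0
    have hpos : ∀ j, 0 < ∑ a, f j a := fun j => lt_of_le_of_ne (hF j) (h0 j).symm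
    have hP : 0 < ∏ j, (∑ a, f j a) ^ w j :=
      Finset.prod_pos fun j _ => Real.rpow_pos_of_pos (hpos j) _
    rw [← div_le_one hP, Finset.sum_div]
    calc ∑ a, (∏ j, f j a ^ w j) / ∏ j, (∑ a, f j a) ^ w j
        = ∑ a, ∏ j, (f j a / ∑ a, f j a) ^ w j := by
          refine Finset.sum_congr rfl fun a _ => ?_
          rw [← Finset.prod_div_distrib]
          exact Finset.prod_congr rfl fun j _ => (Real.div_rpow (hf j a) (hF j) _).symm
      _ ≤ ∑ a, ∑ j, w j * (f j a / ∑ a, f j a) :=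
          Finset.sum_le_sum fun a _ => Real.geom_mean_le_arith_mean_weighted _ _ _
            (fun j _ => (hw j).le) hw1 fun j _ => div_nonneg (hf j a) (hF j)
      _ = 1 := by
          rw [Finset.sum_comm, ← hw1]
          refine Finset.sum_congr rfl fun j _ => ?_
          rw [← Finset.mul_sum, ← Finset.sum_div, div_self (h0 j), mul_one]

theorem sum_rpow_mul_rpow_le {α : Type*} [Fintype α] (u v : α → ℝ) {s t : ℝ}
    (hu : ∀ a, 0 ≤ u a) (hv : ∀ a, 0 ≤ v a) (hs : 0 < s) (ht : 0 < t) (hst : s + t = 1) :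
    ∑ a, u a ^ s * v a ^ t ≤ (∑ a, u a) ^ s * (∑ a, v a) ^ t := by
  have h := sum_prod_rpow_le ![u, v] ![s, t] (by simp [Fin.forall_fin_two, hu, hv])
    (by simp [Fin.forall_fin_two, hs, ht]) (by simpa using hst)
  simpa [Fin.prod_univ_two] using h

theorem sum_eq_sum_insertNth {ι M : Type*} [Fintype ι] [AddCommMonoid M] {n : ℕ}
    (j : Fin (n + 1)) (g : (Fin (n + 1) → ι) → M) :
    ∑ i, g i = ∑ x : Fin n → ι, ∑ k, g (j.insertNth k x) := by
  rw [← (Fin.insertNthEquiv (fun _ => ι) j).sum_comp, Fintype.sum_prod_type_right]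
  rfl

/-- The Loomis–Whitney inequality on a finite grid: a product of functions, the `j`-th of which
ignores the `j`-th coordinate. -/
theorem sum_prod_removeNth_rpow_le {ι : Type*} [Fintype ι] (n : ℕ)
    (f : Fin (n + 2) → (Fin (n + 1) → ι) → ℝ) (hf : ∀ j x, 0 ≤ f j x) :
    ∑ i : Fin (n + 2) → ι, ∏ j, f j (j.removeNth i) ^ (1 / ((n : ℝ) + 1)) ≤
      ∏ j, (∑ x, f j x) ^ (1 / ((n : ℝ) + 1)) := by
  induction n with
  | zero =>
    refine le_of_eq ?_
    rw [sum_eq_sum_insertNth 0]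
    simp only [Fin.prod_univ_succ, Fin.prod_univ_zero, mul_one, Nat.cast_zero, zero_add, div_one,
      Real.rpow_one, Fin.removeNth_insertNth]
    rw [Finset.sum_mul]
    refine Finset.sum_congr rfl fun x _ => ?_
    rw [← Finset.mul_sum, ← (Equiv.funUnique (Fin 1) ι).symm.sum_comp]
    congr 1
    refine Finset.sum_congr rfl fun k _ => congrArg _ ?_
    funext l
    fin_cases l
    rfl
  | succ n ih =>
    have hn : (0 : ℝ) < (n : ℝ) + 1 := by positivity
    have hn' : (0 : ℝ) < (n : ℝ) + 2 := by positivity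
    have hc : ((n + 1 : ℕ) : ℝ) + 1 = (n : ℝ) + 2 := by push_cast; ring
    rw [hc]
    have hremove : ∀ (j : Fin (n + 2)) (a : ι) (x : Fin (n + 2) → ι),
        j.succ.removeNth ((0 : Fin (n + 3)).insertNth a x : Fin (n + 3) → ι) =
          (0 : Fin (n + 2)).insertNth a (j.removeNth x) := by
      intro j a x
      funext l
      refine Fin.cases ?_ (fun l => ?_) l <;> simp [Fin.removeNth]
    rw [sum_eq_sum_insertNth 0, Finset.sum_comm]
    simp only [Fin.prod_univ_succ (n := n + 2), Fin.removeNth_insertNth, hremove]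
    have hnn : ∀ (a : ι) (x : Fin (n + 2) → ι), 0 ≤ ∏ j : Fin (n + 2),
        f j.succ ((0 : Fin (n + 2)).insertNth a (j.removeNth x)) ^ (1 / ((n : ℝ) + 1)) :=
      fun a x => Finset.prod_nonneg fun j _ => Real.rpow_nonneg (hf _ _) _
    have hS : ∀ (a : ι) (j : Fin (n + 2)),
        0 ≤ ∑ y, f j.succ ((0 : Fin (n + 2)).insertNth a y) :=
      fun a j => Finset.sum_nonneg fun y _ => hf _ _
    have hexp : 1 / ((n : ℝ) + 1) * ((n + 1) / (n + 2)) = 1 / ((n : ℝ) + 2) := by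
      field_simp
    -- On each slice, the factor not depending on the first coordinate is split off by Hölder.
    have hslice : ∀ a : ι, ∑ x : Fin (n + 2) → ι, f 0 x ^ (1 / ((n : ℝ) + 2)) *
        ∏ j : Fin (n + 2), f j.succ ((0 : Fin (n + 2)).insertNth a (j.removeNth x)) ^
          (1 / ((n : ℝ) + 2)) ≤
        (∑ x, f 0 x) ^ (1 / ((n : ℝ) + 2)) * ∏ j : Fin (n + 2),
          (∑ y, f j.succ ((0 : Fin (n + 2)).insertNth a y)) ^ (1 / ((n : ℝ) + 2)) := by
      intro a
      have h1 := sum_rpow_mul_rpow_le (fun x => f 0 x) (fun x => ∏ j : Fin (n + 2),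
        f j.succ ((0 : Fin (n + 2)).insertNth a (j.removeNth x)) ^ (1 / ((n : ℝ) + 1)))
        (s := 1 / ((n : ℝ) + 2)) (t := (n + 1) / (n + 2)) (hf 0) (hnn a)
        (by positivity) (by positivity) (by field_simp; ring)
      have h2 := ih (fun j y => f j.succ ((0 : Fin (n + 2)).insertNth a y)) (fun j y => hf _ _)
      have hpow : ∀ g : Fin (n + 2) → ℝ, (∀ j, 0 ≤ g j) →
          (∏ j, g j ^ (1 / ((n : ℝ) + 1))) ^ (((n : ℝ) + 1) / (n + 2)) =
            ∏ j, g j ^ (1 / ((n : ℝ) + 2)) := by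
        intro g hg
        rw [← Real.finsetProd_rpow _ _ fun j _ => Real.rpow_nonneg (hg j) _]
        refine Finset.prod_congr rfl fun j _ => ?_
        rw [← Real.rpow_mul (hg j), hexp]
      rw [← hpow _ (hS a)]
      simp only [hpow _ fun j => hf (Fin.succ j) _] at h1
      refine h1.trans (mul_le_mul_of_nonneg_left ?_ (Real.rpow_nonneg
        (Finset.sum_nonneg fun x _ => hf 0 x) _))
      exact Real.rpow_le_rpow (Finset.sum_nonneg fun x _ => hnn a x) h2 (by positivity)
    refine (Finset.sum_le_sum fun a _ => hslice a).trans ?_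
    rw [← Finset.mul_sum]
    refine mul_le_mul_of_nonneg_left ?_ (Real.rpow_nonneg
        (Finset.sum_nonneg fun x _ => hf 0 x) _)
    refine (sum_prod_rpow_le (fun (j : Fin (n + 2)) a =>
      ∑ y, f j.succ ((0 : Fin (n + 2)).insertNth a y)) (fun _ => 1 / ((n : ℝ) + 2))
      (fun j a => hS a j) (fun _ => by positivity) ?_).trans (le_of_eq ?_)
    · rw [Finset.sum_const, Finset.card_univ, Fintype.card_fin, nsmul_eq_mul]
      push_cast
      field_simp
    · refine Finset.prod_congr rfl fun j _ => ?_
      rw [sum_eq_sum_insertNth 0 (f j.succ), Finset.sum_comm]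

/-! ### Blei's inequality -/

/-- Blei's inequality for the mixed norms with an inner `ℓ²`-norm in one variable. With
`m = n + 2` and `B_j` the sum of `a²` over the `j`-th index, it is Hölder's inequality with `m + 1`
equal weights for `a^{2m/(m+1)} = ((∏ B_j^{1/m}) ∏ (a² B_j^{-1/m}))^{1/(m+1)}`, the first factor
being summed by the Loomis–Whitney inequality. -/
theorem sum_rpow_le_prod_sum_rpow {ι : Type*} [Fintype ι] (n : ℕ)
    (a : (Fin (n + 2) → ι) → ℝ) (ha : ∀ i, 0 ≤ a i) :
    ∑ i, a i ^ (2 * ((n : ℝ) + 2) / (n + 3)) ≤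
      ∏ j : Fin (n + 2), (∑ x : Fin (n + 1) → ι,
        (∑ k, a (j.insertNth k x) ^ 2) ^ (((n : ℝ) + 1) / (n + 2))) ^
          (((n : ℝ) + 2) / ((n + 3) * (n + 1))) := by
  set B : Fin (n + 2) → (Fin (n + 1) → ι) → ℝ :=
    fun j x => ∑ k, a (j.insertNth k x) ^ 2 with hB
  have hB0 : ∀ j x, 0 ≤ B j x := fun j x => Finset.sum_nonneg fun k _ => sq_nonneg _
  -- Where `a` is positive, so is every `B j`, and negative powers of `B j` are meaningful.
  have haB : ∀ j i, a i ^ 2 ≤ B j (j.removeNth i) := by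
    intro j i
    have h := Finset.single_le_sum (f := fun k => a (j.insertNth k (j.removeNth i)) ^ 2)
      (fun k _ => sq_nonneg _) (Finset.mem_univ (i j))
    simpa only [Fin.insertNth_self_removeNth] using h
  set S : Fin (n + 2) → ℝ := fun j => ∑ x, B j x ^ (((n : ℝ) + 1) / (n + 2)) with hS
  have hS0 : ∀ j, 0 ≤ S j := fun j =>
    Finset.sum_nonneg fun x _ => Real.rpow_nonneg (hB0 j x) _
  let F : Fin (n + 3) → (Fin (n + 2) → ι) → ℝ := Fin.cons
    (fun i => ∏ j, (B j (j.removeNth i) ^ (((n : ℝ) + 1) / (n + 2))) ^ (1 / ((n : ℝ) + 1)))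
    (fun j i => a i ^ 2 * B j (j.removeNth i) ^ (-(1 / ((n : ℝ) + 2))))
  have hF0 : ∀ j i, 0 ≤ F j i := by
    intro j i
    refine Fin.cases ?_ (fun j => ?_) j
    · change 0 ≤ ∏ j, (B j (j.removeNth i) ^ (((n : ℝ) + 1) / (n + 2))) ^ (1 / ((n : ℝ) + 1))
      exact Finset.prod_nonneg fun j _ => Real.rpow_nonneg (Real.rpow_nonneg (hB0 _ _) _) _
    · exact mul_nonneg (sq_nonneg _) (Real.rpow_nonneg (hB0 _ _) _)
  have hH := sum_prod_rpow_le F (fun _ => 1 / ((n : ℝ) + 3)) hF0 (fun _ => by positivity)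
    (by rw [Finset.sum_const, Finset.card_univ, Fintype.card_fin, nsmul_eq_mul]
        push_cast; field_simp)
  simp only [Fin.prod_univ_succ (n := n + 2)] at hH
  -- The powers of the `B j` cancel in the product of all factors.
  have hpt : ∀ i, a i ^ (2 * ((n : ℝ) + 2) / (n + 3)) =
      F 0 i ^ (1 / ((n : ℝ) + 3)) * ∏ j : Fin (n + 2), F j.succ i ^ (1 / ((n : ℝ) + 3)) := by
    intro i
    rcases (ha i).eq_or_lt with h0 | h0
    · have : ∏ j : Fin (n + 2), F j.succ i ^ (1 / ((n : ℝ) + 3)) = 0 := by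
        refine Finset.prod_eq_zero (Finset.mem_univ 0) ?_
        have : F (Fin.succ 0) i = 0 := by
          change a i ^ 2 * _ = 0
          rw [← h0]; simp
        rw [this, Real.zero_rpow (by positivity)]
      rw [this, ← h0, mul_zero, Real.zero_rpow (by positivity)]
    · have hBp : ∀ j : Fin (n + 2), 0 < B j (j.removeNth i) := fun j =>
        (by positivity : 0 < a i ^ 2).trans_le (haB j i)
      change _ = (∏ j, (B j (j.removeNth i) ^ (((n : ℝ) + 1) / (n + 2))) ^
        (1 / ((n : ℝ) + 1))) ^ (1 / ((n : ℝ) + 3)) * ∏ j : Fin (n + 2),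
        (a i ^ 2 * B j (j.removeNth i) ^ (-(1 / ((n : ℝ) + 2)))) ^ (1 / ((n : ℝ) + 3))
      rw [← Real.finsetProd_rpow _ _ fun j _ =>
        Real.rpow_nonneg (Real.rpow_nonneg (hB0 _ _) _) _, ← Finset.prod_mul_distrib]
      have : ∀ j : Fin (n + 2), ((B j (j.removeNth i) ^ (((n : ℝ) + 1) / (n + 2))) ^
          (1 / ((n : ℝ) + 1))) ^ (1 / ((n : ℝ) + 3)) *
          (a i ^ 2 * B j (j.removeNth i) ^ (-(1 / ((n : ℝ) + 2)))) ^ (1 / ((n : ℝ) + 3)) =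
          a i ^ (2 / ((n : ℝ) + 3)) := by
        intro j
        rw [Real.mul_rpow (sq_nonneg _) (Real.rpow_nonneg (hB0 _ _) _), ← Real.rpow_mul (hB0 _ _),
          ← Real.rpow_mul (hB0 _ _), ← Real.rpow_mul (hB0 _ _), ← Real.rpow_natCast,
          ← Real.rpow_mul h0.le, mul_left_comm, ← Real.rpow_add (hBp j)]
        have e1 : ((n : ℝ) + 1) / (n + 2) * (1 / ((n : ℝ) + 1)) * (1 / ((n : ℝ) + 3)) +
          -(1 / ((n : ℝ) + 2)) * (1 / ((n : ℝ) + 3)) = 0 := by field_simp; ring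
        rw [e1, Real.rpow_zero, mul_one]
        congr 1
        push_cast
        ring
      simp only [this]
      rw [Finset.prod_const, Finset.card_univ, Fintype.card_fin, ← Real.rpow_natCast,
        ← Real.rpow_mul h0.le]
      congr 1
      push_cast
      ring
  simp only [hpt]
  refine hH.trans ?_
  have hF0sum : ∑ i, F 0 i ≤ ∏ j, S j ^ (1 / ((n : ℝ) + 1)) :=
    sum_prod_removeNth_rpow_le n (fun j x => B j x ^ (((n : ℝ) + 1) / (n + 2)))
      fun j x => Real.rpow_nonneg (hB0 j x) _
  have hFsum : ∀ j : Fin (n + 2), ∑ i, F j.succ i = S j := by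
    intro j
    rw [sum_eq_sum_insertNth j]
    refine Finset.sum_congr rfl fun x _ => ?_
    change ∑ k, a (j.insertNth k x) ^ 2 *
      B j (j.removeNth (j.insertNth k x : Fin (n + 2) → ι)) ^ (-(1 / ((n : ℝ) + 2))) = _
    simp only [Fin.removeNth_insertNth]
    rw [← Finset.sum_mul]
    change B j x * _ = _
    rcases (hB0 j x).eq_or_lt with h0 | h0
    · rw [← h0, zero_mul, Real.zero_rpow (by positivity)]
    · nth_rewrite 1 [← Real.rpow_one (B j x)]
      rw [← Real.rpow_add h0]
      congr 1
      field_simp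
      ring
  simp only [hFsum]
  calc (∑ i, F 0 i) ^ (1 / ((n : ℝ) + 3)) * ∏ j, S j ^ (1 / ((n : ℝ) + 3))
      ≤ (∏ j, S j ^ (1 / ((n : ℝ) + 1))) ^ (1 / ((n : ℝ) + 3)) *
          ∏ j, S j ^ (1 / ((n : ℝ) + 3)) := by
        refine mul_le_mul_of_nonneg_right (Real.rpow_le_rpow
          (Finset.sum_nonneg fun i _ => hF0 0 i) hF0sum (by positivity)) ?_
        exact Finset.prod_nonneg fun j _ => Real.rpow_nonneg (hS0 j) _
    _ = ∏ j, S j ^ (((n : ℝ) + 2) / ((n + 3) * (n + 1))) := by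
        rw [← Real.finsetProd_rpow _ _ fun j _ => Real.rpow_nonneg (hS0 j) _,
          ← Finset.prod_mul_distrib]
        refine Finset.prod_congr rfl fun j _ => ?_
        rw [← Real.rpow_mul (hS0 j), ← Real.rpow_add_of_nonneg (hS0 j) (by positivity)
          (by positivity)]
        congr 1
        field_simp
        ring

/-! ### Khinchine's inequality -/

/-- The sum `∑ ε_k a_k` for a choice of signs `ε`. -/
noncomputable def signSum {𝕜 : Type*} [RCLike 𝕜] {N : ℕ} (a : Fin N → 𝕜) (ε : Fin N → ℤˣ) : 𝕜 :=
  ∑ k, ((ε k : ℤ) : 𝕜) * a k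

theorem sum_signSum_succ {𝕜 : Type*} [RCLike 𝕜] {N : ℕ} (a : Fin (N + 1) → 𝕜) (g : 𝕜 → ℝ) :
    ∑ ε, g (signSum a ε) = ∑ ε, (g (signSum (Fin.tail a) ε + a 0) +
      g (signSum (Fin.tail a) ε - a 0)) := by
  rw [sum_eq_sum_insertNth 0]
  refine Finset.sum_congr rfl fun ε _ => ?_
  have h : ∀ u : ℤˣ, signSum a ((0 : Fin (N + 1)).insertNth u ε) =
      signSum (Fin.tail a) ε + ((u : ℤ) : 𝕜) * a 0 := by
    intro u
    simp [signSum, Fin.sum_univ_succ, Fin.tail, add_comm]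
  simp only [h]
  rw [show (Finset.univ : Finset ℤˣ) = {1, -1} from rfl, Finset.sum_pair (by decide)]
  simp [sub_eq_add_neg]

/-- The second moment of a Rademacher sum; there are `2 ^ N` choices of signs. -/
theorem sum_norm_signSum_sq {𝕜 : Type*} [RCLike 𝕜] {N : ℕ} (a : Fin N → 𝕜) :
    ∑ ε, ‖signSum a ε‖ ^ 2 = 2 ^ N * ∑ k, ‖a k‖ ^ 2 := by
  induction N with
  | zero => simp [signSum]
  | succ N ih =>
    rw [sum_signSum_succ a fun z => ‖z‖ ^ 2]
    have h : ∀ ε, ‖signSum (Fin.tail a) ε + a 0‖ ^ 2 + ‖signSum (Fin.tail a) ε - a 0‖ ^ 2 =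
        2 * ‖signSum (Fin.tail a) ε‖ ^ 2 + 2 * ‖a 0‖ ^ 2 := fun ε => by
      have := parallelogram_law_with_norm 𝕜 (signSum (Fin.tail a) ε) (a 0)
      linarith
    simp only [h]
    rw [Finset.sum_add_distrib, ← Finset.mul_sum, ih, Fin.sum_univ_succ]
    simp only [Fin.tail, Finset.sum_const, Finset.card_univ, Fintype.card_pi,
      Fintype.card_units_int, Finset.prod_const, Fintype.card_fin, nsmul_eq_mul]
    push_cast
    ring

theorem norm_add_pow_four_add_norm_sub_pow_four_le {𝕜 : Type*} [RCLike 𝕜] (x y : 𝕜) :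
    ‖x + y‖ ^ 4 + ‖x - y‖ ^ 4 ≤
      2 * ‖x‖ ^ 4 + 12 * ‖y‖ ^ 2 * ‖x‖ ^ 2 + 2 * ‖y‖ ^ 4 := by
  have h1 := norm_add_sq (𝕜 := 𝕜) x y
  have h2 := norm_sub_sq (𝕜 := 𝕜) x y
  have h3 := abs_le.1 ((RCLike.abs_re_le_norm (inner 𝕜 x y)).trans (norm_inner_le_norm x y))
  set r := RCLike.re (inner 𝕜 x y)
  have h4 : r ^ 2 ≤ (‖x‖ * ‖y‖) ^ 2 := sq_le_sq' h3.1 h3.2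
  have e : ∀ t : ℝ, t ^ 4 = (t ^ 2) ^ 2 := fun t => by ring
  rw [e ‖x + y‖, e ‖x - y‖, h1, h2]
  nlinarith

/-- The fourth moment of a Rademacher sum is at most three times the square of the second. -/
theorem sum_norm_signSum_pow_four_le {𝕜 : Type*} [RCLike 𝕜] {N : ℕ} (a : Fin N → 𝕜) :
    ∑ ε, ‖signSum a ε‖ ^ 4 ≤ 2 ^ N * (3 * (∑ k, ‖a k‖ ^ 2) ^ 2) := by
  induction N with
  | zero => simp [signSum]
  | succ N ih =>
    rw [sum_signSum_succ a fun z => ‖z‖ ^ 4]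
    refine (Finset.sum_le_sum fun ε _ => norm_add_pow_four_add_norm_sub_pow_four_le _ _).trans ?_
    rw [Finset.sum_add_distrib, Finset.sum_add_distrib, ← Finset.mul_sum, ← Finset.mul_sum,
      sum_norm_signSum_sq, Fin.sum_univ_succ]
    simp only [Finset.sum_const, Finset.card_univ, Fintype.card_pi,
      Fintype.card_units_int, Finset.prod_const, Fintype.card_fin, nsmul_eq_mul]
    have h := ih (Fin.tail a)
    have hp : (0 : ℝ) ≤ 2 ^ N * ‖a 0‖ ^ 4 := by positivity
    change _ ≤ 2 ^ (N + 1) * (3 * (‖a 0‖ ^ 2 + ∑ k, ‖Fin.tail a k‖ ^ 2) ^ 2)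
    rw [pow_succ (2 : ℝ)]
    push_cast
    nlinarith

/-- Khinchine's inequality for the exponent `2r/(r+1)`, with a constant tending to `1` as
`r → ∞`: the second moment is interpolated between this one and the fourth. -/
theorem rpow_sum_sq_le_sum_signSum {𝕜 : Type*} [RCLike 𝕜] {N : ℕ} (a : Fin N → 𝕜) {r : ℝ}
    (hr : 0 < r) :
    (∑ k, ‖a k‖ ^ 2) ^ (r / (r + 1)) ≤
      3 ^ (1 / (r + 1)) * ((∑ ε, ‖signSum a ε‖ ^ (2 * r / (r + 1))) / 2 ^ N) := by
  set S := ∑ k, ‖a k‖ ^ 2 with hS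
  set P := (∑ ε, ‖signSum a ε‖ ^ (2 * r / (r + 1))) / 2 ^ N with hP
  have hS0 : 0 ≤ S := Finset.sum_nonneg fun k _ => sq_nonneg _
  have hP0 : 0 ≤ P := div_nonneg
    (Finset.sum_nonneg fun ε _ => Real.rpow_nonneg (norm_nonneg _) _) (by positivity)
  have hN : (0 : ℝ) < 2 ^ N := by positivity
  rcases hS0.eq_or_lt with h0 | h0
  · rw [← h0, Real.zero_rpow (by positivity)]
    positivity
  have hst : (r + 1) / (r + 2) + 1 / (r + 2) = 1 := by field_simp; ring
  have hH := sum_rpow_mul_rpow_le (fun ε => ‖signSum a ε‖ ^ (2 * r / (r + 1)))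
    (fun ε => ‖signSum a ε‖ ^ 4) (s := (r + 1) / (r + 2)) (t := 1 / (r + 2))
    (fun ε => Real.rpow_nonneg (norm_nonneg _) _) (fun ε => by positivity)
    (by positivity) (by positivity) hst
  have hX : ∀ x : ℝ, 0 ≤ x →
      (x ^ (2 * r / (r + 1))) ^ ((r + 1) / (r + 2)) * (x ^ 4) ^ (1 / (r + 2)) = x ^ 2 := by
    intro x hx
    rw [← Real.rpow_natCast x 4, ← Real.rpow_mul hx, ← Real.rpow_mul hx,
      ← Real.rpow_add_of_nonneg hx (by positivity) (by positivity), ← Real.rpow_natCast x 2]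
    congr 1
    push_cast
    field_simp
    ring
  simp only [hX _ (norm_nonneg _)] at hH
  have hPe : ∑ ε, ‖signSum a ε‖ ^ (2 * r / (r + 1)) = 2 ^ N * P := by
    rw [hP]; field_simp
  rw [sum_norm_signSum_sq, hPe] at hH
  have h1 : 2 ^ N * S ≤ 2 ^ N * (P ^ ((r + 1) / (r + 2)) * (3 * S ^ 2) ^ (1 / (r + 2))) := by
    refine hH.trans ((mul_le_mul_of_nonneg_left (Real.rpow_le_rpow
      (Finset.sum_nonneg fun ε _ => by positivity) (sum_norm_signSum_pow_four_le a)
      (by positivity)) (by positivity)).trans (le_of_eq ?_))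
    rw [Real.mul_rpow hN.le hP0, Real.mul_rpow hN.le (by positivity), mul_mul_mul_comm,
      ← Real.rpow_add hN, hst, Real.rpow_one]
  have h2 := le_of_mul_le_mul_left h1 hN
  have hSS : (3 * S ^ 2) ^ (1 / (r + 2)) = 3 ^ (1 / (r + 2)) * S ^ (2 / (r + 2)) := by
    rw [Real.mul_rpow (by norm_num) (by positivity), ← Real.rpow_natCast, ← Real.rpow_mul hS0]
    congr 2
    push_cast
    ring
  have hsplit : S = S ^ (r / (r + 2)) * S ^ (2 / (r + 2)) := by
    rw [← Real.rpow_add h0, ← add_div, div_self (by positivity), Real.rpow_one]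
  have h3 : S ^ (r / (r + 2)) ≤ P ^ ((r + 1) / (r + 2)) * 3 ^ (1 / (r + 2)) := by
    refine le_of_mul_le_mul_right ?_ (Real.rpow_pos_of_pos h0 (2 / (r + 2)))
    rw [← hsplit, mul_assoc, ← hSS]
    exact h2
  have h4 := Real.rpow_le_rpow (by positivity) h3
    (by positivity : 0 ≤ (r + 2) / (r + 1))
  rw [Real.mul_rpow (by positivity) (by positivity), ← Real.rpow_mul hS0, ← Real.rpow_mul hP0,
    ← Real.rpow_mul (by norm_num)] at h4
  have e1 : r / (r + 2) * ((r + 2) / (r + 1)) = r / (r + 1) := by field_simp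
  have e2 : (r + 1) / (r + 2) * ((r + 2) / (r + 1)) = 1 := by field_simp
  have e3 : 1 / (r + 2) * ((r + 2) / (r + 1)) = 1 / (r + 1) := by field_simp
  rw [e1, e2, e3, Real.rpow_one, mul_comm] at h4
  exact h4

/-! ### Multilinear forms on the polydisk -/

theorem polydiskSup_nonneg {𝕜 : Type*} [RCLike 𝕜] {m N : ℕ}
    (U : MultilinearMap 𝕜 (fun _ : Fin m => Fin N → 𝕜) 𝕜) : 0 ≤ polydiskSup U :=
  Real.iSup_nonneg fun _ => norm_nonneg _

/-- The supremum over the open polydisk also bounds the form on the closed polydisk. -/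
theorem norm_le_polydiskSup {𝕜 : Type*} [RCLike 𝕜] {m N : ℕ}
    (U : MultilinearMap 𝕜 (fun _ : Fin m => Fin N → 𝕜) 𝕜) (z : Fin m → Fin N → 𝕜)
    (hz : ∀ k j, ‖z k j‖ ≤ 1) : ‖U z‖ ≤ polydiskSup U := by
  have h : ∀ t : ℝ, t ∈ Set.Ioo (0 : ℝ) 1 → t ^ m * ‖U z‖ ≤ polydiskSup U := by
    intro t ht
    have hmem : ∀ k, (fun k => (t : 𝕜) • z k) k ∈ polydisk 𝕜 N := by
      intro k j
      simp only [Pi.smul_apply, smul_eq_mul, norm_mul, RCLike.norm_ofReal, abs_of_pos ht.1]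
      exact (mul_le_of_le_one_right ht.1.le (hz k j)).trans_lt ht.2
    have h := le_ciSup (bddAbove_polydiskSup U) ⟨_, hmem⟩
    refine le_trans (le_of_eq ?_) h
    simp only [U.map_smul_univ (fun _ => (t : 𝕜)) z, Finset.prod_const, Finset.card_univ,
      Fintype.card_fin, norm_smul, norm_pow, RCLike.norm_ofReal, abs_of_pos ht.1]
  have hlim : Tendsto (fun t : ℝ => t ^ m * ‖U z‖) (𝓝[<] 1) (𝓝 (1 ^ m * ‖U z‖)) :=
    (((continuous_id.pow m).mul continuous_const).tendsto 1).mono_left nhdsWithin_le_nhds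
  rw [one_pow, one_mul] at hlim
  exact le_of_tendsto hlim (by
    filter_upwards [Ioo_mem_nhdsLT (zero_lt_one (α := ℝ))] with t ht using h t ht)

theorem polydiskSup_le {𝕜 : Type*} [RCLike 𝕜] {m N : ℕ}
    (U : MultilinearMap 𝕜 (fun _ : Fin m => Fin N → 𝕜) 𝕜) {M : ℝ}
    (h : ∀ z : Fin m → Fin N → 𝕜, (∀ k j, ‖z k j‖ < 1) → ‖U z‖ ≤ M) : polydiskSup U ≤ M := by
  have : Nonempty {z : Fin m → Fin N → 𝕜 // ∀ k, z k ∈ polydisk 𝕜 N} :=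
    ⟨⟨0, fun k j => by simp⟩⟩
  exact ciSup_le fun z => h z.1 fun k j => z.2 k j

/-- Freezing one argument at a point of the closed polydisk does not increase the supremum. -/
theorem polydiskSup_curryMid_le {𝕜 : Type*} [RCLike 𝕜] {m N : ℕ}
    (U : MultilinearMap 𝕜 (fun _ : Fin (m + 1) => Fin N → 𝕜) 𝕜) (p : Fin (m + 1))
    (v : Fin N → 𝕜) (hv : ∀ j, ‖v j‖ ≤ 1) :
    polydiskSup (m := m) (U.curryMid p v) ≤ polydiskSup U := by
  refine polydiskSup_le _ fun z hz => ?_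
  refine norm_le_polydiskSup U (p.insertNth v z) fun k j => ?_
  refine Fin.succAboveCases p ?_ (fun k => ?_) k
  · simpa using hv j
  · simpa using (hz k j).le

/-! ### Recursion for the Bohnenblust–Hille constants -/

/-- For a linear form the `ℓ¹`-norm of the coefficients is attained on the closed polydisk. -/
theorem admissible_one (𝕜 : Type*) [RCLike 𝕜] : Admissible 𝕜 1 1 := by
  intro N _ U
  have hexp : (2 * ((1 : ℕ) : ℝ) / (((1 : ℕ) : ℝ) + 1)) = 1 := by norm_num
  have hexp' : ((((1 : ℕ) : ℝ) + 1) / (2 * ((1 : ℕ) : ℝ))) = 1 := by norm_num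
  rw [hexp, hexp', Real.rpow_one, one_mul]
  simp only [Real.rpow_one]
  rw [← (Equiv.funUnique (Fin 1) (Fin N)).symm.sum_comp]
  set b : Fin N → 𝕜 := fun j => U fun _ => stdVec 𝕜 j with hb
  -- Coordinates of modulus at most one rotating all the coefficients onto the positive half-line.
  have hc : ∀ w : 𝕜, ∃ c : 𝕜, ‖c‖ ≤ 1 ∧ c * w = (‖w‖ : 𝕜) := by
    intro w
    obtain ⟨c, hc, h⟩ := RCLike.exists_norm_eq_mul_self w
    exact ⟨c, hc.le, h.symm⟩
  choose c hc1 hc2 using hc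
  have hU : U (fun _ => ∑ j, c (b j) • stdVec 𝕜 j) = ((∑ j, ‖b j‖ : ℝ) : 𝕜) := by
    rw [U.map_sum, ← (Equiv.funUnique (Fin 1) (Fin N)).symm.sum_comp]
    push_cast
    refine Finset.sum_congr rfl fun j _ => ?_
    refine Eq.trans ?_ (hc2 (b j))
    have := U.map_smul_univ (fun _ => c (b j)) (fun _ => stdVec 𝕜 j)
    simpa [hb] using this
  have h := norm_le_polydiskSup U (fun _ => ∑ j, c (b j) • stdVec 𝕜 j) fun k j => by
    simpa [stdVec, Pi.single_apply] using hc1 (b j)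
  rw [hU, RCLike.norm_ofReal, abs_of_nonneg (Finset.sum_nonneg fun j _ => norm_nonneg _)] at h
  exact h

theorem one_le_of_admissible {𝕜 : Type*} [RCLike 𝕜] {m : ℕ} {C : ℝ}
    (hC : Admissible 𝕜 m C) : 1 ≤ C := by
  -- The product of the coordinates on the one-dimensional space.
  let U : MultilinearMap 𝕜 (fun _ : Fin m => Fin 1 → 𝕜) 𝕜 :=
    (MultilinearMap.mkPiAlgebra 𝕜 (Fin m) 𝕜).compLinearMap fun _ => LinearMap.proj 0
  have hU : ∀ z, U z = ∏ k, z k 0 := fun z => rfl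
  have h := hC 1 le_rfl U
  have hs : polydiskSup U ≤ 1 := polydiskSup_le U fun z hz => by
    rw [hU, norm_prod]
    exact Finset.prod_le_one (fun _ _ => norm_nonneg _) fun k _ => (hz k 0).le
  have hs0 := polydiskSup_nonneg U
  have hone : ∀ i : Fin m → Fin 1, U (fun k => stdVec 𝕜 (i k)) = 1 := fun i => by
    rw [hU]
    exact Finset.prod_eq_one fun k _ => by simp [stdVec, Subsingleton.elim (i k) 0]
  simp only [hone, norm_one, Real.one_rpow, Finset.sum_const, Finset.card_univ,
    Fintype.card_unique, one_smul] at h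
  by_contra! hC1
  have h1 : 1 ≤ polydiskSup U := by nlinarith
  rw [le_antisymm hs h1, mul_one] at h
  exact absurd hC1 h.not_gt

/-- The recursion `K_{n+2} ≤ 3^{1/(2(n+1))} K_{n+1}`. In each mixed norm of Blei's inequality the
inner `ℓ²`-norm is replaced by an average over signs; the outer exponent `2(n+1)/(n+2)` is exactly
the Bohnenblust–Hille exponent of degree `n+1`, which applies to the form with one argument frozen
at a vector of signs. -/
theorem Admissible.succ {𝕜 : Type*} [RCLike 𝕜] {n : ℕ} {C : ℝ} (hC : Admissible 𝕜 (n + 1) C) :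
    Admissible 𝕜 (n + 2) (3 ^ (1 / (2 * ((n : ℝ) + 1))) * C) := by
  intro N hN U
  have hC0 : 0 ≤ C := zero_le_one.trans (one_le_of_admissible hC)
  have hσ := polydiskSup_nonneg U
  set σ := polydiskSup U with hσd
  set a : (Fin (n + 2) → Fin N) → ℝ := fun i => ‖U fun k => stdVec 𝕜 (i k)‖ with ha
  set p : ℝ := 2 * ((n : ℝ) + 1) / (n + 2) with hp
  have hp0 : 0 < p := by positivity
  have hc : (((n + 1 : ℕ) : ℝ)) + 1 = (n : ℝ) + 2 := by push_cast; ring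
  -- The inequality of one degree less, raised to the power `p`, for a slice of `U` at a vector
  -- of signs.
  have hslice : ∀ (j : Fin (n + 2)) (ε : Fin N → ℤˣ), ∑ x : Fin (n + 1) → Fin N,
      ‖signSum (fun k => U fun l => stdVec 𝕜
        ((j.insertNth k x : Fin (n + 2) → Fin N) l)) ε‖ ^ p ≤ (C * σ) ^ p := by
    intro j ε
    set v : Fin N → 𝕜 := fun k => ((ε k : ℤ) : 𝕜) with hv
    have hv1 : ∀ k, ‖v k‖ ≤ 1 := fun k => by
      rcases Int.units_eq_one_or (ε k) with h | h <;> simp [hv, h]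
    have h := hC N hN (U.curryMid j v)
    rw [hc, Nat.cast_add, Nat.cast_one] at h
    have hval : ∀ x : Fin (n + 1) → Fin N, U.curryMid j v (fun k => stdVec 𝕜 (x k)) =
        signSum (fun k => U fun l => stdVec 𝕜 ((j.insertNth k x : Fin (n + 2) → Fin N) l)) ε := by
      intro x
      have hvs : v = ∑ k, v k • stdVec 𝕜 k := by
        funext l
        simp [stdVec, Pi.single_apply]
      rw [hvs, map_sum, _root_.sum_apply]
      refine Finset.sum_congr rfl fun k _ => ?_
      rw [map_smul, _root_.smul_apply, smul_eq_mul, MultilinearMap.curryMid_apply_apply]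
      congr 2
      funext l
      refine Fin.succAboveCases j ?_ (fun l => ?_) l <;> simp
    simp only [hval] at h
    have hT : 0 ≤ ∑ x : Fin (n + 1) → Fin N, ‖signSum (fun k => U fun l => stdVec 𝕜
        ((j.insertNth k x : Fin (n + 2) → Fin N) l)) ε‖ ^ p :=
      Finset.sum_nonneg fun x _ => Real.rpow_nonneg (norm_nonneg _) _
    have h' := Real.rpow_le_rpow (Real.rpow_nonneg hT _)
      (h.trans (mul_le_mul_of_nonneg_left (polydiskSup_curryMid_le U j v hv1) hC0)) hp0.le
    rw [← Real.rpow_mul hT] at h'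
    have e : ((n : ℝ) + 2) / (2 * ((n : ℝ) + 1)) * p = 1 := by rw [hp]; field_simp
    rwa [e, Real.rpow_one] at h'
  set T : ℝ := 3 ^ (1 / ((n : ℝ) + 2)) * (C * σ) ^ p with hTd
  have hT0 : 0 ≤ T := by positivity
  -- Khinchine in the `j`-th index, then the slice bound averaged over all signs.
  have hS : ∀ j : Fin (n + 2), ∑ x : Fin (n + 1) → Fin N,
      (∑ k, a (j.insertNth k x) ^ 2) ^ (((n : ℝ) + 1) / (n + 2)) ≤ T := by
    intro j
    have e1 : (n : ℝ) + 1 + 1 = n + 2 := by ring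
    have hK : ∀ x : Fin (n + 1) → Fin N, _ := fun x =>
      rpow_sum_sq_le_sum_signSum (fun k => U fun l => stdVec 𝕜
        ((j.insertNth k x : Fin (n + 2) → Fin N) l)) (r := (n : ℝ) + 1) (by positivity)
    rw [e1] at hK
    refine (Finset.sum_le_sum fun x _ => hK x).trans ?_
    rw [← Finset.mul_sum, ← Finset.sum_div, Finset.sum_comm]
    refine mul_le_mul_of_nonneg_left ?_ (by positivity)
    rw [div_le_iff₀ (by positivity)]
    refine (Finset.sum_le_sum fun ε _ => hslice j ε).trans (le_of_eq ?_)
    simp [mul_comm]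
  have hB := sum_rpow_le_prod_sum_rpow n a fun i => norm_nonneg _
  set q : ℝ := 2 * ((n : ℝ) + 2) / (n + 3) with hq
  have hq0 : 0 < q := by positivity
  have hle : ∑ i, a i ^ q ≤ (3 ^ (1 / (2 * ((n : ℝ) + 1))) * C * σ) ^ q := by
    refine hB.trans ((Finset.prod_le_prod (fun j _ => Real.rpow_nonneg
      (Finset.sum_nonneg fun x _ => Real.rpow_nonneg
        (Finset.sum_nonneg fun k _ => sq_nonneg _) _) _)
      fun j _ => Real.rpow_le_rpow (Finset.sum_nonneg fun x _ => Real.rpow_nonneg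
        (Finset.sum_nonneg fun k _ => sq_nonneg _) _) (hS j) (by positivity)).trans (le_of_eq ?_))
    rw [Finset.prod_const, Finset.card_univ, Fintype.card_fin, ← Real.rpow_natCast,
      ← Real.rpow_mul hT0, hTd, Real.mul_rpow (by positivity) (by positivity),
      ← Real.rpow_mul (by norm_num), ← Real.rpow_mul (by positivity), mul_assoc _ C σ,
      Real.mul_rpow (y := C * σ) (by positivity) (by positivity),
      ← Real.rpow_mul (x := 3) (by norm_num)]
    congr 2
    · rw [hq]; push_cast; field_simp
    · rw [hq, hp]; push_cast; field_simp
  have e2 : ((n + 2 : ℕ) : ℝ) = (n : ℝ) + 2 := by push_cast; ring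
  have e3 : (n : ℝ) + 2 + 1 = n + 3 := by ring
  rw [e2, e3]
  refine (Real.rpow_le_rpow (Finset.sum_nonneg fun i _ => Real.rpow_nonneg (norm_nonneg _) _) hle
    (by positivity)).trans (le_of_eq ?_)
  have e4 : q * (((n : ℝ) + 3) / (2 * ((n : ℝ) + 2))) = 1 := by rw [hq]; field_simp
  rw [← Real.rpow_mul (by positivity), e4, Real.rpow_one]

/-! ### Growth of the constants -/

/-- An upper bound for the optimal constants, `3^{(1 + 1/2 + ⋯ + 1/(m-1))/2}`; the truncated
subtraction gives the value `1` at `m = 0`, as at `m = 1`. -/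
noncomputable def upperConst (m : ℕ) : ℝ :=
  3 ^ (∑ k ∈ Finset.range (m - 1), 1 / (2 * ((k : ℝ) + 1)))

theorem upperConst_pos (m : ℕ) : 0 < upperConst m :=
  Real.rpow_pos_of_pos (by norm_num) _

theorem monotone_upperConst : Monotone upperConst := by
  intro m n h
  refine Real.rpow_le_rpow_of_exponent_le (by norm_num) ?_
  exact Finset.sum_le_sum_of_subset_of_nonneg (Finset.range_mono (by omega))
    fun k _ _ => by positivity

theorem upperConst_add_two (n : ℕ) :
    upperConst (n + 2) = 3 ^ (1 / (2 * ((n : ℝ) + 1))) * upperConst (n + 1) := by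
  unfold upperConst
  rw [show n + 2 - 1 = n + 1 from rfl, show n + 1 - 1 = n from rfl, Finset.sum_range_succ,
    Real.rpow_add (by norm_num), mul_comm]

theorem admissible_upperConst (𝕜 : Type*) [RCLike 𝕜] {m : ℕ} (hm : 1 ≤ m) :
    Admissible 𝕜 m (upperConst m) := by
  induction m, hm using Nat.le_induction with
  | base => simpa [upperConst] using admissible_one 𝕜
  | succ m hm ih =>
    obtain ⟨n, rfl⟩ := Nat.exists_eq_add_of_le' hm
    rw [upperConst_add_two]
    exact ih.succ

theorem tendsto_upperConst_ratio :
    Tendsto (fun m : ℕ => upperConst (m + 1) / upperConst m) atTop (𝓝 1) := by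
  rw [← tendsto_add_atTop_iff_nat 1]
  have h : ∀ n : ℕ, upperConst (n + 1 + 1) / upperConst (n + 1) =
      3 ^ (1 / 2 * (1 / ((n : ℝ) + 1))) := fun n => by
    rw [upperConst_add_two, mul_div_cancel_right₀ _ (upperConst_pos _).ne']
    congr 1
    field_simp
  simp only [h]
  have h2 : Tendsto (fun n : ℕ => 1 / 2 * (1 / ((n : ℝ) + 1))) atTop (𝓝 (1 / 2 * 0)) :=
    tendsto_one_div_add_atTop_nhds_zero_nat.const_mul _
  have h3 := (Real.continuous_const_rpow (a := 3) (by norm_num)).tendsto (1 / 2 * 0) |>.comp h2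
  simpa [Function.comp_def] using h3

theorem isLeast_optConst (𝕜 : Type*) [RCLike 𝕜] {m : ℕ} (hm : 1 ≤ m) :
    IsLeast {C : ℝ | Admissible 𝕜 m C} (optConst 𝕜 m) := by
  have hbdd : BddBelow {C : ℝ | Admissible 𝕜 m C} := ⟨1, fun C hC => one_le_of_admissible hC⟩
  have hcl : IsClosed {C : ℝ | Admissible 𝕜 m C} := by
    simp only [Admissible, Set.ofPred_forall]
    exact isClosed_iInter fun N => isClosed_iInter fun _ => isClosed_iInter fun U =>
      isClosed_le continuous_const (continuous_id.mul continuous_const)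
  exact ⟨hcl.csInf_mem ⟨_, admissible_upperConst 𝕜 hm⟩ hbdd, fun C hC => csInf_le hbdd hC⟩

/-- The ratio test for sequences that are eventually positive. -/
theorem tendsto_zero_of_ratio {u : ℕ → ℝ} {L : ℝ} (hL : L < 1) (hu : ∀ᶠ m in atTop, 0 < u m)
    (h : Tendsto (fun m => u (m + 1) / u m) atTop (𝓝 L)) : Tendsto u atTop (𝓝 0) := by
  refine (summable_of_ratio_test_tendsto_lt_one hL (hu.mono fun m hm => hm.ne')
    (h.congr' ?_)).tendsto_atTop_zero
  filter_upwards [hu, (tendsto_add_atTop_nat 1).eventually hu] with m h1 h2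
  rw [Real.norm_of_nonneg h1.le, Real.norm_of_nonneg h2.le]

theorem one_le_of_tendsto_ratio {u : ℕ → ℝ} {L : ℝ} (hu : ∀ m, 1 ≤ m → 1 ≤ u m)
    (h : Tendsto (fun m => u (m + 1) / u m) atTop (𝓝 L)) : 1 ≤ L := by
  by_contra! hL
  have hu' : ∀ᶠ m in atTop, 1 ≤ u m := eventually_atTop.2 ⟨1, hu⟩
  have h0 := tendsto_zero_of_ratio hL (hu'.mono fun m hm => zero_lt_one.trans_le hm) h
  exact absurd (ge_of_tendsto h0 hu') (by norm_num)

theorem tendsto_optConst_div_pow (𝕜 : Type*) [RCLike 𝕜] {a : ℝ} (ha : 1 < a) :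
    Tendsto (fun m => optConst 𝕜 m / a ^ m) atTop (𝓝 0) := by
  have ha0 : 0 < a := zero_lt_one.trans ha
  have h : Tendsto (fun m => upperConst m / a ^ m) atTop (𝓝 0) := by
    refine tendsto_zero_of_ratio (L := 1 / a) ((div_lt_one ha0).2 ha)
      (Eventually.of_forall fun m => div_pos (upperConst_pos m) (by positivity)) ?_
    refine (tendsto_upperConst_ratio.div_const a).congr fun m => ?_
    have := (upperConst_pos m).ne'
    rw [pow_succ]
    field_simp
  refine tendsto_of_tendsto_of_tendsto_of_le_of_le' tendsto_const_nhds h ?_ ?_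
  · filter_upwards [eventually_ge_atTop 1] with m hm
    exact div_nonneg (zero_le_one.trans
      (one_le_of_admissible (isLeast_optConst 𝕜 hm).1)) (by positivity)
  · filter_upwards [eventually_ge_atTop 1] with m hm
    exact div_le_div_of_nonneg_right ((isLeast_optConst 𝕜 hm).2 (admissible_upperConst 𝕜 hm))
      (by positivity)

/-- A ratio limit above `1` would force exponential growth of the optimal constants. -/
theorem ratio_limit_optConst_le_one (𝕜 : Type*) [RCLike 𝕜] {L : ℝ}
    (h : Tendsto (fun m => optConst 𝕜 (m + 1) / optConst 𝕜 m) atTop (𝓝 L)) : L ≤ 1 := by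
  by_contra! hL
  obtain ⟨a, ha1, haL⟩ := exists_between hL
  have ha0 : 0 < a := zero_lt_one.trans ha1
  have hpos : ∀ᶠ m in atTop, 0 < optConst 𝕜 m := by
    filter_upwards [eventually_ge_atTop 1] with m hm
    exact zero_lt_one.trans_le (one_le_of_admissible (isLeast_optConst 𝕜 hm).1)
  have h1 : Tendsto (fun m => a ^ m / optConst 𝕜 m) atTop (𝓝 0) := by
    refine tendsto_zero_of_ratio (L := a / L) ((div_lt_one (ha0.trans haL)).2 haL)
      (hpos.mono fun m hm => by positivity) ?_
    refine ((tendsto_const_nhds (x := a)).div h (ha0.trans haL).ne').congr' ?_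
    filter_upwards [hpos, (tendsto_add_atTop_nat 1).eventually hpos] with m h1 h2
    change a / (optConst 𝕜 (m + 1) / optConst 𝕜 m) = _
    rw [pow_succ]
    field_simp
  have h2 := h1.mul (tendsto_optConst_div_pow 𝕜 ha1)
  rw [mul_zero] at h2
  refine zero_ne_one (tendsto_nhds_unique h2 (tendsto_const_nhds.congr' ?_))
  filter_upwards [hpos] with m hm
  field_simp

end BohnenblustHille

theorem mainTheorem2 (𝕜 : Type*) [RCLike 𝕜] :
    -- `K_m` is the least admissible constant (in particular it is finite), and `K_m ≥ 1`
    (∀ m : ℕ, 1 ≤ m →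
      IsLeast {C : ℝ | BohnenblustHille.Admissible 𝕜 m C} (BohnenblustHille.optConst 𝕜 m) ∧
      1 ≤ BohnenblustHille.optConst 𝕜 m) ∧
    -- the optimal constants are bounded above by a sequence with ratios tending to `1`
    (∃ C : ℕ → ℝ, Monotone C ∧ (∀ m, 0 < C m) ∧
      (∀ m : ℕ, 1 ≤ m → BohnenblustHille.optConst 𝕜 m ≤ C m) ∧
      Tendsto (fun m : ℕ => C (m + 1) / C m) atTop (𝓝 1)) ∧
    -- ratio limit `1` is the best possible: no sequence of admissible constants does better
    (∀ (C : ℕ → ℝ) (L : ℝ), (∀ m : ℕ, 1 ≤ m → BohnenblustHille.Admissible 𝕜 m (C m)) →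
      Tendsto (fun m : ℕ => C (m + 1) / C m) atTop (𝓝 L) → 1 ≤ L) ∧
    -- the only possible limit of the ratios of the optimal constants themselves is `1`
    (∀ L : ℝ, Tendsto (fun m : ℕ => BohnenblustHille.optConst 𝕜 (m + 1) /
        BohnenblustHille.optConst 𝕜 m) atTop (𝓝 L) → L = 1) ∧
    -- subexponential growth of the optimal constants
    (∀ a : ℝ, 1 < a →
      (fun m : ℕ => BohnenblustHille.optConst 𝕜 m) =o[atTop] (fun m : ℕ => a ^ m)) := by
  refine ⟨fun m hm => ?_, ⟨BohnenblustHille.upperConst, ?_⟩, fun C L hC h => ?_, fun L h => ?_,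
    fun a ha => ?_⟩
  · have h := BohnenblustHille.isLeast_optConst 𝕜 hm
    exact ⟨h, BohnenblustHille.one_le_of_admissible h.1⟩
  · exact ⟨BohnenblustHille.monotone_upperConst, BohnenblustHille.upperConst_pos,
      fun m hm => (BohnenblustHille.isLeast_optConst 𝕜 hm).2
        (BohnenblustHille.admissible_upperConst 𝕜 hm),
      BohnenblustHille.tendsto_upperConst_ratio⟩
  · exact BohnenblustHille.one_le_of_tendsto_ratio
      (fun m hm => BohnenblustHille.one_le_of_admissible (hC m hm)) h
  · refine le_antisymm (BohnenblustHille.ratio_limit_optConst_le_one 𝕜 h) ?_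
    exact BohnenblustHille.one_le_of_tendsto_ratio (fun m hm =>
      BohnenblustHille.one_le_of_admissible (BohnenblustHille.isLeast_optConst 𝕜 hm).1) h
  · have ha0 : 0 < a := zero_lt_one.trans ha
    exact (isLittleO_iff_tendsto fun m hm => absurd hm (pow_pos ha0 m).ne').2
      (BohnenblustHille.tendsto_optConst_div_pow 𝕜 ha)
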